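/- Let $H$ be a complex Hilbert space of finite dimension $N$ with scalar product $(\cdot,\cdot)$ (linear in the second argument), let $\Omega$ and $B$ be self-adjoint operators on $H$ with $B\ge 0$ and $0<N_B<N$, where $N_B:=\operatorname{rank}B$, and let $A(\beta)=\Omega-\mathrm{i}\beta B$ for real $\beta\ge 0$. Write $H_B=\operatorname{ran}B$, so that $H_B^{\perp}=\ker B$. A function $f(\beta)$ of a large real parameter $\beta$ is called analytic at $\beta=\infty$ (respectively, is said to have a pole at $\beta=\infty$) if $f(\beta)=g(1/\beta)$ for all sufficiently large $\beta$, where $g$ is a function of a complex variable that is analytic at $0$ (respectively, meromorphic at $0$ with a pole at $0$). Let $\mathring{\zeta}_j$, $1\le j\le N_B$, be any indexing of all the nonzero eigenvalues of $B$, counting multiplicities. Then $A(\beta)$ is diagonalizable for all sufficiently large $\beta$, and there exist functions $\zeta_j(\beta)\in\mathbb{C}$ and $w_j(\beta)\in H$, $1\le j\le N$, such that for all sufficiently large $\beta$ the vectors $w_1(\beta),\dots,w_N(\beta)$ form a basis of $H$ and $$A(\beta)w_j(\beta)=\zeta_j(\beta)w_j(\beta),\qquad 1\le j\le N,$$ and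 such that these eigenpairs split into two classes, high-loss ($1\le j\le N_B$) and low-loss ($N_B+1\le j\le N$), with the following properties. (i) For $1\le j\le N_B$, the eigenvalue $\zeta_j$ has a pole at $\beta=\infty$ and the eigenvector $w_j$ is analytic at $\beta=\infty$. There are numbers $\rho_j\in\mathbb{R}$ and vectors $\mathring{w}_j\in H$ such that, as $\beta\to\infty$, $$\zeta_j(\beta)=-\mathrm{i}\mathring{\zeta}_j\beta+\rho_j+O(\beta^{-1}),\qquad \mathring{\zeta}_j>0,\qquad w_j(\beta)=\mathring{w}_j+O(\beta^{-1}).$$ The vectors $\mathring{w}_j$, $1\le j\le N_B$, form an orthonormal basis of $H_B$, and $B\mathring{w}_j=\mathring{\zeta}_j\mathring{w}_j$, $\rho_j=(\mathring{w}_j,\Omega\mathring{w}_j)$. (ii) For $N_B+1\le j\le N$, both $\zeta_j$ and $w_j$ are analytic at $\beta=\infty$. There are numbers $\rho_j\in\mathbb{R}$, $d_j\ge 0$ and vectors $\mathring{w}_j,w_j^{(-1)}\in H$ such that, as $\beta\to\infty$, $$\zeta_j(\beta)=\rho_j-\mathrm{i}d_j\beta^{-1}+O(\beta^{-2}),\qquad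 w_j(\beta)=\mathring{w}_j+w_j^{(-1)}\beta^{-1}+O(\beta^{-2}).$$ The vectors $\mathring{w}_j$, $N_B+1\le j\le N$, form an orthonormal basis of $H_B^{\perp}=\ker B$, and $B\mathring{w}_j=0$, $\rho_j=(\mathring{w}_j,\Omega\mathring{w}_j)$, $d_j=(w_j^{(-1)},Bw_j^{(-1)})$. -/

import Mathlib

open Filter Asymptotics

/-- The system operator `A(β) = Ω - i β B`, with loss parameter `β`. -/
noncomputable def systemOperator {H : Type*} [NormedAddCommGroup H] [InnerProductSpace ℂ H]
    (Ω B : Module.End ℂ H) (β : ℝ) : Module.End ℂ H :=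
  Ω - (Complex.I * (β : ℂ)) • B

/-- The loss subspace `H_B`, the range of `B`. -/
def lossSubspace {H : Type*} [NormedAddCommGroup H] [InnerProductSpace ℂ H]
    (B : Module.End ℂ H) : Submodule ℂ H :=
  LinearMap.range B

/-- The no-loss subspace, the orthogonal complement of the loss subspace. -/
noncomputable def noLossSubspace {H : Type*} [NormedAddCommGroup H] [InnerProductSpace ℂ H]
    (B : Module.End ℂ H) : Submodule ℂ H :=
  (lossSubspace B)ᗮ

/-- `ζ` lists all the nonzero eigenvalues of `B`, each as often as its multiplicity
(for the self-adjoint `B` considered here this is the dimension of the eigenspace). All complex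
numbers `μ ≠ 0` are considered; those which are not eigenvalues have eigenspace of dimension `0`. -/
def IsIndexingOfNonzeroEigenvalues {H : Type*} [NormedAddCommGroup H] [InnerProductSpace ℂ H]
    (B : Module.End ℂ H) {n : ℕ} (ζ : Fin n → ℝ) : Prop :=
  (∀ j, ζ j ≠ 0) ∧
    ∀ μ : ℂ, μ ≠ 0 →
      Nat.card {j : Fin n // (ζ j : ℂ) = μ} = Module.finrank ℂ (Module.End.eigenspace B μ)

/-- A function of a large real parameter `β` is analytic at `β = ∞`: for all large `β` it is
`g (1 / β)` for a function `g` which is complex analytic at `0`. -/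
def IsAnalyticAtInfinity {E : Type*} [NormedAddCommGroup E] [NormedSpace ℂ E]
    (f : ℝ → E) : Prop :=
  ∃ g : ℂ → E, AnalyticAt ℂ g 0 ∧ ∀ᶠ β : ℝ in atTop, f β = g ((β : ℂ)⁻¹)

/-- A function of a large real parameter `β` has a pole at `β = ∞`: for all large `β` it is
`g (1 / β)` for a function `g` which is meromorphic at `0` and has a pole there. -/
def HasPoleAtInfinity (f : ℝ → ℂ) : Prop :=
  ∃ g : ℂ → ℂ, MeromorphicAt g 0 ∧ meromorphicOrderAt g 0 < 0 ∧
    ∀ᶠ β : ℝ in atTop, f β = g ((β : ℂ)⁻¹)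

/-- A linear operator is diagonalizable if the space has a basis of eigenvectors. -/
def IsDiagonalizable {H : Type*} [NormedAddCommGroup H] [InnerProductSpace ℂ H]
    (T : Module.End ℂ H) : Prop :=
  ∃ (b : Module.Basis (Fin (Module.finrank ℂ H)) ℂ H) (μ : Fin (Module.finrank ℂ H) → ℂ),
    ∀ j, T (b j) = μ j • b j

/-- `v` is an orthonormal basis of the subspace `S`. -/
def IsOrthonormalBasisOf {H : Type*} [NormedAddCommGroup H] [InnerProductSpace ℂ H]
    {ι : Type*} (v : ι → H) (S : Submodule ℂ H) : Prop :=
  Orthonormal ℂ v ∧ Submodule.span ℂ (Set.range v) = S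

/-! With t = i/β one has A(β) = -iβ(B + tΩ), so everything reduces to the pencil B + tΩ near t = 0.
The pencil is self-adjoint for real t, so Rellich's theorem
(`IsSymmetrizedBy.hasAnalyticEigenbasis`) supplies eigenvalues μ_j(t) and eigenvectors v_j(t)
analytic in a complex neighbourhood of 0, orthonormal at t = 0. They are evaluated at the imaginary
points i/β.

Rellich's theorem is an induction on dimension. Subtract the mean eigenvalue and divide by the
leading power of t: the new value at 0 is self-adjoint, nonzero and traceless, hence not scalar. One
of its eigenspaces splits the family analytically into two smaller blocks
(`exists_analyticAt_blockDiagonalization`, by the implicit function theorem). The conjugation is not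
unitary, so the induction hypothesis allows symmetry with respect to a varying Hermitian form.

The coefficients of ζ_j = -iβ μ_j(i/β) come from `exists_perturbation_expansion`. High loss is
μ_j(0) ≠ 0, low loss is μ_j(0) = 0. -/

open scoped Topology ContDiff

/-! ### Block diagonal parts with respect to a subspace and its orthogonal complement -/

section BlockDiagonalization

variable {E : Type*} [NormedAddCommGroup E] [InnerProductSpace ℂ E] [FiniteDimensional ℂ E]

/-- The block diagonal part of an operator with respect to `K ⊕ Kᗮ`. -/
noncomputable def blockDiagonal (K : Submodule ℂ E) : (E →L[ℂ] E) →L[ℂ] (E →L[ℂ] E) :=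
  ContinuousLinearMap.mulLeftRight ℂ (E →L[ℂ] E) K.starProjection K.starProjection +
    ContinuousLinearMap.mulLeftRight ℂ (E →L[ℂ] E) Kᗮ.starProjection Kᗮ.starProjection

theorem blockDiagonal_apply (K : Submodule ℂ E) (Z : E →L[ℂ] E) (x : E) :
    blockDiagonal K Z x = K.starProjection (Z (K.starProjection x)) +
      Kᗮ.starProjection (Z (Kᗮ.starProjection x)) := by
  simp [blockDiagonal]

theorem blockDiagonal_apply_of_mem (K : Submodule ℂ E) (Z : E →L[ℂ] E) {x : E} (hx : x ∈ K) :
    blockDiagonal K Z x = K.starProjection (Z x) := by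
  have h : Kᗮ.starProjection x = 0 := by
    rw [Submodule.starProjection_apply_eq_zero_iff]
    exact K.le_orthogonal_orthogonal hx
  rw [blockDiagonal_apply, h, Submodule.starProjection_eq_self_iff.2 hx]
  simp

theorem blockDiagonal_apply_of_mem_orthogonal (K : Submodule ℂ E) (Z : E →L[ℂ] E) {x : E}
    (hx : x ∈ Kᗮ) : blockDiagonal K Z x = Kᗮ.starProjection (Z x) := by
  have h : K.starProjection x = 0 := by
    simp [Submodule.starProjection_apply_eq_zero_iff, hx]
  rw [blockDiagonal_apply, h, Submodule.starProjection_eq_self_iff.2 hx]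
  simp

theorem blockDiagonal_eq_self_of_mapsTo (K : Submodule ℂ E) {Z : E →L[ℂ] E}
    (h₁ : ∀ x ∈ K, Z x ∈ K) (h₂ : ∀ x ∈ Kᗮ, Z x ∈ Kᗮ) : blockDiagonal K Z = Z := by
  ext x
  rw [blockDiagonal_apply,
    Submodule.starProjection_eq_self_iff.2 (h₁ _ (Submodule.starProjection_apply_mem _ _)),
    Submodule.starProjection_eq_self_iff.2 (h₂ _ (Submodule.starProjection_apply_mem _ _)),
    ← map_add, Submodule.starProjection_add_starProjection_orthogonal]

theorem blockDiagonal_mapsTo (K : Submodule ℂ E) (Z : E →L[ℂ] E) {x : E} (hx : x ∈ K) :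
    blockDiagonal K Z x ∈ K := by
  rw [blockDiagonal_apply_of_mem K Z hx]
  exact Submodule.starProjection_apply_mem _ _

theorem blockDiagonal_mapsTo_orthogonal (K : Submodule ℂ E) (Z : E →L[ℂ] E) {x : E}
    (hx : x ∈ Kᗮ) : blockDiagonal K Z x ∈ Kᗮ := by
  rw [blockDiagonal_apply_of_mem_orthogonal K Z hx]
  exact Submodule.starProjection_apply_mem _ _

theorem blockDiagonal_idem (K : Submodule ℂ E) (Z : E →L[ℂ] E) :
    blockDiagonal K (blockDiagonal K Z) = blockDiagonal K Z :=
  blockDiagonal_eq_self_of_mapsTo K (fun _ hx => blockDiagonal_mapsTo K Z hx)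
    (fun _ hx => blockDiagonal_mapsTo_orthogonal K Z hx)

/-- An operator commuting with a symmetric operator `T` is block diagonal with respect to each
eigenspace of `T`. -/
theorem blockDiagonal_eq_self_of_commute {T Y : E →L[ℂ] E} (hT : IsSelfAdjoint T) (c : ℂ)
    (h : Commute T Y) : blockDiagonal (Module.End.eigenspace (T : E →ₗ[ℂ] E) c) Y = Y := by
  have hTs : (T : E →ₗ[ℂ] E).IsSymmetric := hT.isSymmetric
  have hc : ∀ x, T (Y x) = Y (T x) := fun x => by
    simpa using congrArg (fun Z : E →L[ℂ] E => Z x) h.eq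
  set K := Module.End.eigenspace (T : E →ₗ[ℂ] E) c with hK
  have hmem : ∀ x, x ∈ K ↔ T x = c • x := fun x => by
    simp [hK]
  refine blockDiagonal_eq_self_of_mapsTo _ (fun x hx => ?_) (fun x hx => ?_)
  · rw [hmem] at hx ⊢
    rw [hc, hx, map_smul]
  · by_cases hbot : K = ⊥
    · simp [hbot]
    have hev : Module.End.HasEigenvalue (T : E →ₗ[ℂ] E) c := hbot
    have hcr : (starRingEnd ℂ) c = c := hTs.conj_eigenvalue_eq_self hev
    -- Since c is real, `Kᗮ` is the range of T - c, which every operator commuting with T preserves;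
    -- no adjoint of `Y` is needed.
    have hsub : ((T : E →ₗ[ℂ] E) - c • (1 : E →ₗ[ℂ] E)).IsSymmetric := by
      refine hTs.sub (fun x y => ?_)
      simp [inner_smul_left, inner_smul_right, hcr]
    have hker : K = LinearMap.ker ((T : E →ₗ[ℂ] E) - c • (1 : E →ₗ[ℂ] E)) := by
      ext x
      simp [hmem, sub_eq_zero]
    have hran : Kᗮ = LinearMap.range ((T : E →ₗ[ℂ] E) - c • (1 : E →ₗ[ℂ] E)) := by
      rw [hker, ← hsub.orthogonal_range, Submodule.orthogonal_orthogonal]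
    rw [hran] at hx ⊢
    obtain ⟨y, rfl⟩ := hx
    exact ⟨Y y, by simp [hc]⟩

/-- A block diagonal `T` commutes with both projections. Consequently the commutator of `T` with an
operator of zero block diagonal part again has zero block diagonal part. -/
theorem blockDiagonal_mul {K : Submodule ℂ E} {T : E →L[ℂ] E} (hT : blockDiagonal K T = T)
    (Y : E →L[ℂ] E) :
    blockDiagonal K (T * Y) = T * blockDiagonal K Y ∧
      blockDiagonal K (Y * T) = blockDiagonal K Y * T := by
  have hP : ∀ x, K.starProjection (T x) = T (K.starProjection x) ∧
      Kᗮ.starProjection (T x) = T (Kᗮ.starProjection x) := by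
    intro x
    have hx := Submodule.starProjection_add_starProjection_orthogonal (K := K) x
    have h₁ : T (K.starProjection x) ∈ K := by
      rw [← hT]
      exact blockDiagonal_mapsTo K _ (Submodule.starProjection_apply_mem _ _)
    have h₂ : T (Kᗮ.starProjection x) ∈ Kᗮ := by
      rw [← hT]
      exact blockDiagonal_mapsTo_orthogonal K _ (Submodule.starProjection_apply_mem _ _)
    have h₃ : K.starProjection (T x) = T (K.starProjection x) := by
      conv_lhs => rw [← hx, map_add, map_add, Submodule.starProjection_eq_self_iff.2 h₁,
        (Submodule.starProjection_apply_eq_zero_iff _).2 h₂, add_zero]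
    refine ⟨h₃, ?_⟩
    rw [Submodule.starProjection_orthogonal_val, h₃, Submodule.starProjection_orthogonal_val,
      map_sub]
  constructor
  · ext x
    simp only [blockDiagonal_apply, mul_apply_eq_comp, (hP _).1, (hP _).2, map_add]
  · ext x
    simp only [blockDiagonal_apply, mul_apply_eq_comp, (hP _).1, (hP _).2]

end BlockDiagonalization

/-! ### Analytic block diagonalization by the implicit function theorem -/

section ImplicitFunction

variable {R : Type*} [NormedRing R] [NormedAlgebra ℂ R]

theorem hasFDerivAt_conjugation_equation (diag off : R →L[ℂ] R) {T : R} (hd : diag T = T)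
    (ho : off T = 0) :
    ∃ L : R →L[ℂ] R, HasFDerivAt (fun Z => T * (1 + off Z) - (1 + off Z) * diag Z) L T ∧
      ∀ Z, L Z = T * off Z - off Z * T - diag Z := by
  have h : HasFDerivAt (fun Z => 1 + off Z) off T := off.hasFDerivAt.const_add 1
  refine ⟨_, (h.const_mul T).sub (h.mul' (diag.hasFDerivAt (x := T))), fun Z => ?_⟩
  simp [ho, hd, sub_sub, add_comm]

variable [FiniteDimensional ℂ R]

/-- Solution by the implicit function theorem of the equation
`S t * (1 + off Z) = (1 + off Z) * diag Z`. -/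
theorem exists_analyticAt_conjugation {S : ℂ → R} (hS : AnalyticAt ℂ S 0) (diag off : R →L[ℂ] R)
    (hd : diag (S 0) = S 0) (ho : off (S 0) = 0)
    (hinj : ∀ Z, S 0 * off Z - off Z * S 0 - diag Z = 0 → Z = 0) :
    ∃ Z : ℂ → R, AnalyticAt ℂ Z 0 ∧ Z 0 = S 0 ∧
      ∀ᶠ t in 𝓝 0, S t * (1 + off (Z t)) = (1 + off (Z t)) * diag (Z t) := by
  have : CompleteSpace R := FiniteDimensional.complete ℂ R
  -- A single unknown carries both the conjugator `1 + off Z` and the conjugated operator `diag Z`,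
  -- so there are as many equations as unknowns, and in finite dimension injectivity of the partial
  -- derivative suffices.
  let f : ℂ × R → R := fun p => S p.1 * (1 + off p.2) - (1 + off p.2) * diag p.2
  have hf : AnalyticAt ℂ f (0, S 0) := by
    have h₁ : AnalyticAt ℂ (fun p : ℂ × R => S p.1) (0, S 0) :=
      AnalyticAt.comp (g := S) (f := Prod.fst) hS analyticAt_fst
    have h₂ : AnalyticAt ℂ (fun p : ℂ × R => off p.2) (0, S 0) :=
      (off.comp (ContinuousLinearMap.snd ℂ ℂ R)).analyticAt _
    have h₃ : AnalyticAt ℂ (fun p : ℂ × R => diag p.2) (0, S 0) :=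
      (diag.comp (ContinuousLinearMap.snd ℂ ℂ R)).analyticAt _
    exact (h₁.mul (analyticAt_const.add h₂)).sub ((analyticAt_const.add h₂).mul h₃)
  have hfc : ContDiffAt ℂ ω f (0, S 0) := hf.contDiffAt
  obtain ⟨L, hL, hLZ⟩ := hasFDerivAt_conjugation_equation diag off hd ho
  have hfL : fderiv ℂ f (0, S 0) ∘L .inr ℂ ℂ R = L :=
    (hf.differentiableAt.hasFDerivAt.comp (S 0) (hasFDerivAt_prodMk_right 0 (S 0))).unique hL
  have hLinj : Function.Injective (L : R →ₗ[ℂ] R) := by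
    rw [injective_iff_map_eq_zero]
    intro Z hZ
    exact hinj Z (by rw [← hLZ]; exact hZ)
  have hinv : (fderiv ℂ f (0, S 0) ∘L .inr ℂ ℂ R).IsInvertible := by
    rw [hfL]
    exact ⟨(LinearEquiv.ofInjectiveEndo (L : R →ₗ[ℂ] R) hLinj).toContinuousLinearEquiv,
      by ext; rfl⟩
  refine ⟨hfc.implicitFunction (by simp) hinv,
    (hfc.contDiffAt_implicitFunction (by simp) hinv).analyticAt,
    hfc.implicitFunction_apply_self (by simp) hinv, ?_⟩
  filter_upwards [hfc.eventually_apply_implicitFunction (by simp) hinv] with t ht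
  have h0 : f (0, S 0) = 0 := by simp [f, ho, hd]
  rw [h0] at ht
  exact sub_eq_zero.1 ht

end ImplicitFunction

/-- Analytic block diagonalization of an analytic family near a self-adjoint operator, with respect
to one of the eigenspaces of the latter. -/
theorem exists_analyticAt_blockDiagonalization {E : Type*} [NormedAddCommGroup E]
    [InnerProductSpace ℂ E] [FiniteDimensional ℂ E] {S : ℂ → E →L[ℂ] E} (hS : AnalyticAt ℂ S 0)
    (hS₀ : IsSelfAdjoint (S 0)) (c : ℂ) :
    ∃ V D : ℂ → E →L[ℂ] E, AnalyticAt ℂ V 0 ∧ AnalyticAt ℂ D 0 ∧ V 0 = 1 ∧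
      (∀ᶠ t in 𝓝 0, S t * V t = V t * D t) ∧
      ∀ t, blockDiagonal (Module.End.eigenspace (S 0 : E →ₗ[ℂ] E) c) (D t) = D t := by
  have hcomm : ∀ Y, Commute (S 0) Y →
      blockDiagonal (Module.End.eigenspace (S 0 : E →ₗ[ℂ] E) c) Y = Y :=
    fun Y hY => blockDiagonal_eq_self_of_commute hS₀ c hY
  generalize Module.End.eigenspace (S 0 : E →ₗ[ℂ] E) c = K at hcomm
  have hd₀ : blockDiagonal K (S 0) = S 0 := hcomm _ (Commute.refl _)
  let off : (E →L[ℂ] E) →L[ℂ] (E →L[ℂ] E) := ContinuousLinearMap.id ℂ _ - blockDiagonal K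
  have hoff : ∀ Z, off Z = Z - blockDiagonal K Z := fun Z => rfl
  obtain ⟨Z, hZ, hZ₀, hSZ⟩ := exists_analyticAt_conjugation hS (blockDiagonal K) off hd₀
    (by rw [hoff, hd₀, sub_self]) (by
      -- The block diagonal part of the linearized equation gives `blockDiagonal K Z = 0`. What
      -- remains says that `Z` commutes with `S 0`, so `Z` is also block diagonal, hence zero.
      intro Z hZ
      have hdo : blockDiagonal K (off Z) = 0 := by
        rw [hoff, map_sub, blockDiagonal_idem, sub_self]
      have hdZ : blockDiagonal K Z = 0 := by
        have := congrArg (blockDiagonal K) hZ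
        rw [map_sub, map_sub, (blockDiagonal_mul hd₀ _).1, (blockDiagonal_mul hd₀ _).2, hdo,
          blockDiagonal_idem, mul_zero, zero_mul, map_zero, sub_zero, zero_sub, neg_eq_zero] at this
        exact this
      have hoZ : off Z = Z := by rw [hoff, hdZ, sub_zero]
      rw [hdZ, sub_zero, sub_eq_zero] at hZ
      rw [← hoZ, ← hcomm _ hZ, hdo])
  refine ⟨fun t => 1 + off (Z t), fun t => blockDiagonal K (Z t),
    analyticAt_const.add ((off.analyticAt _).comp hZ), ((blockDiagonal K).analyticAt _).comp hZ,
    ?_, hSZ, fun t => blockDiagonal_idem K _⟩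
  simp only [hZ₀, hoff, hd₀, sub_self, add_zero]

theorem ContinuousAt.eq_of_eventually_nhdsNE {𝕜 F : Type*} [NontriviallyNormedField 𝕜]
    [TopologicalSpace F] [T2Space F] {f g : 𝕜 → F} {x : 𝕜} (hf : ContinuousAt f x)
    (hg : ContinuousAt g x) (h : ∀ᶠ t in 𝓝[≠] x, f t = g t) : ∀ᶠ t in 𝓝 x, f t = g t :=
  (hf.eventuallyEq_nhds_iff_eventuallyEq_nhdsNE hg).1 h

theorem AnalyticAt.apply_of_clm {E F : Type*} [NormedAddCommGroup E] [NormedSpace ℂ E]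
    [NormedAddCommGroup F] [NormedSpace ℂ F] {V : ℂ → E →L[ℂ] F} {v : ℂ → E} {z : ℂ}
    (hV : AnalyticAt ℂ V z) (hv : AnalyticAt ℂ v z) : AnalyticAt ℂ (fun t => V t (v t)) z :=
  AnalyticAt.comp (g := fun x : (E →L[ℂ] F) × E => ContinuousLinearMap.id ℂ (E →L[ℂ] F) x.1 x.2)
    ((ContinuousLinearMap.id ℂ (E →L[ℂ] F)).analyticAt_bilinear _) (hV.prod hv)

/-! ### Reality of the trace of a symmetrizable operator -/

section Trace

variable {E : Type*} [NormedAddCommGroup E] [InnerProductSpace ℂ E] [FiniteDimensional ℂ E]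

/-- The trace as a continuous linear functional. -/
noncomputable def traceL : (E →L[ℂ] E) →L[ℂ] ℂ :=
  LinearMap.toContinuousLinearMap
    ((LinearMap.trace ℂ E) ∘ₗ (ContinuousLinearMap.coeLM ℂ : (E →L[ℂ] E) →ₗ[ℂ] (E →ₗ[ℂ] E)))

theorem traceL_apply (X : E →L[ℂ] E) : traceL X = LinearMap.trace ℂ E (X : E →ₗ[ℂ] E) := rfl

theorem traceL_mul_comm (X Y : E →L[ℂ] E) : traceL (X * Y) = traceL (Y * X) :=
  LinearMap.trace_mul_comm ℂ (X : E →ₗ[ℂ] E) (Y : E →ₗ[ℂ] E)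

theorem traceL_one : traceL (1 : E →L[ℂ] E) = Module.finrank ℂ E :=
  LinearMap.trace_one ℂ E

theorem traceL_star (X : E →L[ℂ] E) : traceL (star X) = star (traceL X) := by
  rw [traceL_apply, traceL_apply, LinearMap.trace_eq_sum_inner _ (stdOrthonormalBasis ℂ E),
    LinearMap.trace_eq_sum_inner _ (stdOrthonormalBasis ℂ E), star_sum]
  refine Finset.sum_congr rfl fun i _ => ?_
  rw [ContinuousLinearMap.star_eq_adjoint]
  simp [ContinuousLinearMap.adjoint_inner_right]

/-- The trace of an operator which is symmetric with respect to an invertible Hermitian form is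
real. -/
theorem star_traceL_eq_self {G X : E →L[ℂ] E} (hG : IsUnit G) (hGs : IsSelfAdjoint G)
    (hGX : IsSelfAdjoint (G * X)) : star (traceL X) = traceL X := by
  obtain ⟨u, rfl⟩ := hG
  have h : star X * u = u * X := by
    have := hGX.star_eq
    rwa [star_mul, hGs.star_eq] at this
  -- `X` is similar to its adjoint, so its trace equals its own conjugate.
  have hX : X = (↑u⁻¹ : E →L[ℂ] E) * (star X * u) := by
    rw [h, ← mul_assoc, Units.inv_mul, one_mul]
  conv_rhs => rw [hX, traceL_mul_comm, mul_assoc, Units.mul_inv, mul_one]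
  exact (traceL_star X).symm

end Trace

/-- `M` has, near `0`, analytic eigenvalues and eigenvectors, the latter forming an orthonormal
basis at `0`. -/
def HasAnalyticEigenbasis {E : Type*} [NormedAddCommGroup E] [InnerProductSpace ℂ E]
    (M : ℂ → E →L[ℂ] E) : Prop :=
  ∃ (ι : Type) (_ : Fintype ι) (b : OrthonormalBasis ι ℂ E) (v : ι → ℂ → E) (μ : ι → ℂ → ℂ),
    ∀ j, AnalyticAt ℂ (v j) 0 ∧ AnalyticAt ℂ (μ j) 0 ∧ v j 0 = b j ∧
      ∀ᶠ t in 𝓝 0, M t (v j t) = μ j t • v j t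

/-- Shifting and rescaling a family preserves analytic eigenbases. -/
theorem HasAnalyticEigenbasis.of_eventually_eq {E : Type*} [NormedAddCommGroup E]
    [InnerProductSpace ℂ E] {M S : ℂ → E →L[ℂ] E} {c a : ℂ → ℂ}
    (hS : HasAnalyticEigenbasis S) (hc : AnalyticAt ℂ c 0) (ha : AnalyticAt ℂ a 0)
    (h : ∀ᶠ t in 𝓝 0, M t = c t • (1 : E →L[ℂ] E) + a t • S t) : HasAnalyticEigenbasis M := by
  obtain ⟨ι, _, b, v, μ, hb⟩ := hS
  refine ⟨ι, inferInstance, b, v, fun j t => c t + a t * μ j t, fun j => ?_⟩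
  obtain ⟨h₁, h₂, h₃, h₄⟩ := hb j
  refine ⟨h₁, hc.add (ha.mul h₂), h₃, ?_⟩
  filter_upwards [h, h₄] with t ht ht'
  simp [ht, ht', add_smul, mul_smul]

/-! ### Compressions and the gluing of analytic eigenbases -/

section Eigenbasis

variable {E : Type*} [NormedAddCommGroup E] [InnerProductSpace ℂ E] [FiniteDimensional ℂ E]

/-- The compression of an operator to a subspace. -/
noncomputable def compression (K : Submodule ℂ E) (T : E →L[ℂ] E) : K →L[ℂ] K :=
  K.orthogonalProjectionOnto ∘L T ∘L K.subtypeL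

theorem coe_compression_apply {K : Submodule ℂ E} {T : E →L[ℂ] E} (hT : ∀ x ∈ K, T x ∈ K) (x : K) :
    (compression K T x : E) = T x :=
  Submodule.starProjection_eq_self_iff.2 (hT x x.2)

theorem compression_mul {K : Submodule ℂ E} {S T : E →L[ℂ] E} (hT : ∀ x ∈ K, T x ∈ K) :
    compression K S * compression K T = compression K (S * T) := by
  ext x
  change ((compression K S (compression K T x) : K) : E) = _
  simp [compression, Submodule.starProjection_eq_self_iff.2 (hT x x.2)]

theorem compression_one (K : Submodule ℂ E) : compression K 1 = 1 := by
  ext x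
  simp [compression]

theorem IsSelfAdjoint.compression {T : E →L[ℂ] E} (hT : IsSelfAdjoint T) (K : Submodule ℂ E) :
    IsSelfAdjoint (compression K T) := by
  rw [ContinuousLinearMap.isSelfAdjoint_iff']
  simp only [_root_.compression, ContinuousLinearMap.adjoint_comp, Submodule.adjoint_subtypeL,
    Submodule.adjoint_orthogonalProjectionOnto, hT.adjoint_eq, ContinuousLinearMap.comp_assoc]

theorem continuous_compression (K : Submodule ℂ E) :
    Continuous (compression K : (E →L[ℂ] E) → (K →L[ℂ] K)) := by
  unfold compression
  fun_prop

theorem analyticAt_compression (K : Submodule ℂ E) {D : ℂ → E →L[ℂ] E} (hD : AnalyticAt ℂ D 0) :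
    AnalyticAt ℂ (fun t => compression K (D t)) 0 :=
  (((ContinuousLinearMap.compL ℂ K E K K.orthogonalProjectionOnto).comp
    ((ContinuousLinearMap.compL ℂ K E E).flip K.subtypeL)).analyticAt _).comp hD

/-- Analytic eigenbases of the compressions to `K` and `Kᗮ` of a block diagonal family give one of
each similar family. -/
theorem hasAnalyticEigenbasis_of_compression {S V D : ℂ → E →L[ℂ] E} {K : Submodule ℂ E}
    (hV : AnalyticAt ℂ V 0) (hV₀ : V 0 = 1) (hSV : ∀ᶠ t in 𝓝 0, S t * V t = V t * D t)
    (hD : ∀ t, blockDiagonal K (D t) = D t)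
    (h₁ : HasAnalyticEigenbasis fun t => compression K (D t))
    (h₂ : HasAnalyticEigenbasis fun t => compression Kᗮ (D t)) : HasAnalyticEigenbasis S := by
  have key : ∀ (L : Submodule ℂ E), (∀ t, ∀ x ∈ L, D t x ∈ L) → ∀ (b : L) (v : ℂ → L) (μ : ℂ → ℂ),
      AnalyticAt ℂ v 0 ∧ AnalyticAt ℂ μ 0 ∧ v 0 = b ∧
        (∀ᶠ t in 𝓝 0, compression L (D t) (v t) = μ t • v t) →
      AnalyticAt ℂ (fun t => V t (v t)) 0 ∧ AnalyticAt ℂ μ 0 ∧ V 0 (v 0) = (b : E) ∧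
        ∀ᶠ t in 𝓝 0, S t (V t (v t)) = μ t • V t (v t) := by
    rintro L hL b v μ ⟨hv, hμ, hb, hev⟩
    refine ⟨?_, hμ, by simp [hV₀, hb], ?_⟩
    · exact hV.apply_of_clm ((L.subtypeL.analyticAt _).comp hv)
    · filter_upwards [hSV, hev] with t h₁ h₂
      have h₃ := congrArg (fun T : E →L[ℂ] E => T (v t)) h₁
      simp only [mul_apply_eq_comp] at h₃
      rw [h₃, ← coe_compression_apply (hL t), h₂]
      simp
  obtain ⟨ι₁, _, b₁, v₁, μ₁, h₁⟩ := h₁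
  obtain ⟨ι₂, _, b₂, v₂, μ₂, h₂⟩ := h₂
  have hon : Orthonormal ℂ (Sum.elim (fun i => (b₁ i : E)) fun i => (b₂ i : E)) := by
    classical
    have e₁ := b₁.orthonormal
    have e₂ := b₂.orthonormal
    rw [orthonormal_iff_ite] at e₁ e₂ ⊢
    rintro (i | i) (j | j)
    · simpa using e₁ i j
    · simpa using (Submodule.mem_orthogonal _ _).1 (b₂ j).2 _ (b₁ i).2
    · simpa using (Submodule.mem_orthogonal' _ _).1 (b₂ i).2 _ (b₁ j).2
    · simpa using e₂ i j
  have hspan : ∀ (L : Submodule ℂ E) (ι : Type) (_ : Fintype ι) (b : OrthonormalBasis ι ℂ L),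
      Submodule.span ℂ (Set.range fun i => (b i : E)) = L := by
    intro L ι _ b
    have := congrArg (Submodule.map L.subtype) b.toBasis.span_eq
    rwa [Submodule.map_span, ← Set.range_comp, Submodule.map_top, Submodule.range_subtype] at this
  refine ⟨ι₁ ⊕ ι₂, inferInstance, OrthonormalBasis.mk hon ?_,
    Sum.elim (fun i t => V t (v₁ i t)) fun i t => V t (v₂ i t), Sum.elim μ₁ μ₂, ?_⟩
  · rw [Set.Sum.elim_range, Submodule.span_union, hspan, hspan,
      Submodule.sup_orthogonal_of_hasOrthogonalProjection]
  · rintro (i | i)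
    · simpa using key K (fun t x hx => hD t ▸ blockDiagonal_mapsTo K _ hx) _ _ _ (h₁ i)
    · simpa using key Kᗮ (fun t x hx => hD t ▸ blockDiagonal_mapsTo_orthogonal K _ hx) _ _ _ (h₂ i)

theorem hasAnalyticEigenbasis_zero : HasAnalyticEigenbasis fun _ => (0 : E →L[ℂ] E) :=
  ⟨_, inferInstance, stdOrthonormalBasis ℂ E, fun j _ => stdOrthonormalBasis ℂ E j, fun _ _ => 0,
    fun j => ⟨analyticAt_const, analyticAt_const, rfl, by simp⟩⟩

end Eigenbasis

/-- Near `0`, on the real axis, `M` is symmetric with respect to Hermitian forms `G` which tend to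
the scalar product. -/
structure IsSymmetrizedBy {E : Type*} [NormedAddCommGroup E] [InnerProductSpace ℂ E]
    [CompleteSpace E] (M : ℂ → E →L[ℂ] E) (G : ℝ → E →L[ℂ] E) : Prop where
  analyticAt : AnalyticAt ℂ M 0
  continuousAt : ContinuousAt G 0
  map_zero : G 0 = 1
  isSelfAdjoint : ∀ᶠ t in 𝓝 0, IsSelfAdjoint (G t)
  isSelfAdjoint_mul : ∀ᶠ t : ℝ in 𝓝 0, IsSelfAdjoint (G t * M t)

/-! ### Families symmetric with respect to a varying Hermitian form -/

section Symmetrized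

variable {E : Type*} [NormedAddCommGroup E] [InnerProductSpace ℂ E] [FiniteDimensional ℂ E]

theorem tendsto_ofReal_nhds_zero : Tendsto (fun t : ℝ => (t : ℂ)) (𝓝 0) (𝓝 0) := by
  simpa using Complex.continuous_ofReal.tendsto 0

/-- Pulling the form back along V gives V*GV, and V*GV·D = V*(GS)V is self-adjoint for real t. This
stability under non-unitary conjugation and compression is what the induction in Rellich's theorem
needs. -/
theorem IsSymmetrizedBy.compression {S V D : ℂ → E →L[ℂ] E} {G : ℝ → E →L[ℂ] E}
    (h : IsSymmetrizedBy S G) (hV : AnalyticAt ℂ V 0) (hD : AnalyticAt ℂ D 0) (hV₀ : V 0 = 1)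
    (hSV : ∀ᶠ t in 𝓝 0, S t * V t = V t * D t) {K : Submodule ℂ E}
    (hK : ∀ t, ∀ x ∈ K, D t x ∈ K) :
    IsSymmetrizedBy (fun t => compression K (D t))
      fun t => compression K (star (V t) * G t * V t) := by
  have hVc : ContinuousAt (fun t : ℝ => V t) 0 := by
    refine ContinuousAt.comp (g := V) ?_ Complex.continuous_ofReal.continuousAt
    simpa using hV.continuousAt
  refine ⟨analyticAt_compression K hD, ?_, ?_, ?_, ?_⟩
  · exact (continuous_compression K).continuousAt.comp ((hVc.star.mul h.continuousAt).mul hVc)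
  · simp [hV₀, h.map_zero, compression_one]
  · filter_upwards [h.isSelfAdjoint] with t ht
    exact (ht.conjugate' (V t)).compression K
  · filter_upwards [h.isSelfAdjoint_mul, tendsto_ofReal_nhds_zero.eventually hSV] with t ht ht'
    rw [compression_mul (hK _), mul_assoc, ← ht', ← mul_assoc, mul_assoc _ (G t)]
    exact (ht.conjugate' (V t)).compression K

/-- Dividing the traceless part of a symmetrized family by the leading power. -/
theorem IsSymmetrizedBy.exists_traceless {M : ℂ → E →L[ℂ] E} {G : ℝ → E →L[ℂ] E}
    (h : IsSymmetrizedBy M G) :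
    ∃ c : ℂ → ℂ, AnalyticAt ℂ c 0 ∧
      ((∀ᶠ t in 𝓝 0, M t = c t • (1 : E →L[ℂ] E)) ∨
      ∃ (k : ℕ) (S : ℂ → E →L[ℂ] E), IsSymmetrizedBy S G ∧ S 0 ≠ 0 ∧ traceL (S 0) = 0 ∧
        ∀ᶠ t in 𝓝 0, M t = c t • (1 : E →L[ℂ] E) + t ^ k • S t) := by
  let c : ℂ → ℂ := fun t => traceL (M t) / Module.finrank ℂ E
  have hc : AnalyticAt ℂ c 0 := by
    exact ((traceL.analyticAt _).comp h.analyticAt).div_const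
  have hN : AnalyticAt ℂ (fun t => M t - c t • (1 : E →L[ℂ] E)) 0 :=
    h.analyticAt.sub (hc.smul analyticAt_const)
  refine ⟨c, hc, ?_⟩
  -- An analytic function either vanishes identically near 0 or has a finite order `k` there.
  by_cases hz : ∀ᶠ t in 𝓝 0, M t - c t • (1 : E →L[ℂ] E) = 0
  · exact Or.inl (hz.mono fun t ht => sub_eq_zero.1 ht)
  obtain ⟨k, S, hS, hS₀, hk⟩ := hN.exists_eventuallyEq_pow_smul_nonzero_iff.2 hz
  simp only [sub_zero] at hk
  have hE : (Module.finrank ℂ E : ℂ) ≠ 0 := by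
    intro h0
    have : Subsingleton E := Module.finrank_zero_iff.1 (by exact_mod_cast h0)
    exact hS₀ (Subsingleton.elim _ _)
  have hScR : ContinuousAt (fun t : ℝ => S t) 0 := by
    refine ContinuousAt.comp (g := S) ?_ Complex.continuous_ofReal.continuousAt
    simpa using hS.continuousAt
  refine Or.inr ⟨k, S, ⟨hS, h.continuousAt, h.map_zero, h.isSelfAdjoint, ?_⟩, hS₀, ?_,
    hk.mono fun t ht => by rw [← ht]; abel⟩
  -- For real t ≠ 0 symmetry survives subtracting `c t`, which is real as a normalized trace, and
  -- dividing by the real number t^k; continuity then gives t = 0.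
  · have hunit : ∀ᶠ t in 𝓝 0, IsUnit (G t) := by
      refine h.continuousAt.eventually (Units.isOpen.eventually_mem ?_)
      rw [h.map_zero]
      exact isUnit_one
    refine (ContinuousAt.eq_of_eventually_nhdsNE (h.continuousAt.mul hScR).star
      (h.continuousAt.mul hScR) ?_)
    filter_upwards [hunit.filter_mono nhdsWithin_le_nhds,
      h.isSelfAdjoint.filter_mono nhdsWithin_le_nhds,
      h.isSelfAdjoint_mul.filter_mono nhdsWithin_le_nhds,
      (tendsto_ofReal_nhds_zero.eventually hk).filter_mono nhdsWithin_le_nhds,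
      self_mem_nhdsWithin] with t h₁ h₂ h₃ h₄ ht
    have htk : ((t : ℂ) ^ k) ≠ 0 := pow_ne_zero _ (by exact_mod_cast ht)
    have hcs : star (c t) = c t := by
      simp only [c, star_div₀, star_traceL_eq_self h₁ h₂ h₃, star_natCast]
    have hcomb : (t : ℂ) ^ k • (G t * S t) = G t * M t - c t • G t := by
      rw [← mul_smul_comm, ← h₄, mul_sub, mul_smul_comm, mul_one]
    have hst : star ((t : ℂ) ^ k • (G t * S t)) = (t : ℂ) ^ k • (G t * S t) := by
      rw [hcomb, star_sub, star_smul, h₂.star_eq, h₃.star_eq, hcs]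
    have htr : star ((t : ℂ) ^ k) = (t : ℂ) ^ k := by simp
    rw [star_smul, htr] at hst
    exact smul_right_injective _ htk hst
  · refine (ContinuousAt.eq_of_eventually_nhdsNE (f := fun t => traceL (S t)) (g := fun _ => 0)
      (traceL.continuous.continuousAt.comp hS.continuousAt) continuousAt_const ?_).self_of_nhds
    filter_upwards [hk.filter_mono nhdsWithin_le_nhds, self_mem_nhdsWithin] with t ht ht'
    have := congrArg traceL ht
    rw [map_sub, map_smul, map_smul, traceL_one] at this
    simp only [c, smul_eq_mul, div_mul_cancel₀ _ hE, sub_self] at this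
    exact (mul_eq_zero.1 this.symm).resolve_left (pow_ne_zero _ ht')

end Symmetrized

/-- **Rellich's theorem** in finite dimension. -/
theorem IsSymmetrizedBy.hasAnalyticEigenbasis {E : Type*} [NormedAddCommGroup E]
    [InnerProductSpace ℂ E] [FiniteDimensional ℂ E] {M : ℂ → E →L[ℂ] E} {G : ℝ → E →L[ℂ] E}
    (h : IsSymmetrizedBy M G) : HasAnalyticEigenbasis M := by
  induction hn : Module.finrank ℂ E using Nat.strong_induction_on generalizing E with
  | _ n ih =>
  obtain ⟨c, hc, hM | ⟨k, S, hS, hS₀, htr, hM⟩⟩ := h.exists_traceless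
  · exact hasAnalyticEigenbasis_zero.of_eventually_eq hc (analyticAt_const (v := 0))
      (hM.mono fun t ht => by simp [ht])
  refine HasAnalyticEigenbasis.of_eventually_eq ?_ hc (analyticAt_id.pow k) hM
  have hE : Nontrivial E := by
    by_contra hE
    rw [not_nontrivial_iff_subsingleton] at hE
    exact hS₀ (Subsingleton.elim _ _)
  have hsa : IsSelfAdjoint (S 0) := by
    simpa [hS.map_zero] using hS.isSelfAdjoint_mul.self_of_nhds
  obtain ⟨c₀, hc₀⟩ := Module.End.exists_eigenvalue (S 0 : E →ₗ[ℂ] E)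
  obtain ⟨V, D, hV, hD, hV₀, hSV, hbd⟩ := exists_analyticAt_blockDiagonalization hS.analyticAt hsa c₀
  have hbot : Module.End.eigenspace (S 0 : E →ₗ[ℂ] E) c₀ ≠ ⊥ := hc₀
  -- A traceless scalar operator is zero, so the eigenspace is proper and both blocks have smaller
  -- dimension.
  have htop : Module.End.eigenspace (S 0 : E →ₗ[ℂ] E) c₀ ≠ ⊤ := by
    intro htop
    have hsc : S 0 = c₀ • 1 := by
      ext x
      have hx : x ∈ Module.End.eigenspace (S 0 : E →ₗ[ℂ] E) c₀ := htop ▸ Submodule.mem_top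
      simpa using Module.End.mem_eigenspace_iff.1 hx
    rw [hsc, map_smul, traceL_one, smul_eq_mul, mul_eq_zero, Nat.cast_eq_zero] at htr
    refine hS₀ ?_
    rw [hsc, htr.resolve_right Module.finrank_pos.ne', zero_smul]
  generalize Module.End.eigenspace (S 0 : E →ₗ[ℂ] E) c₀ = K at hbd hbot htop
  have hsum := K.finrank_add_finrank_orthogonal
  have hKpos : 0 < Module.finrank ℂ K :=
    Module.finrank_pos_iff.2 (Submodule.nontrivial_iff_ne_bot.2 hbot)
  have hKlt : Module.finrank ℂ K < Module.finrank ℂ E := Submodule.finrank_lt htop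
  exact hasAnalyticEigenbasis_of_compression hV hV₀ hSV hbd
    (ih _ (by omega)
      (hS.compression hV hD hV₀ hSV fun t x hx => hbd t ▸ blockDiagonal_mapsTo K _ hx) rfl)
    (ih _ (by omega)
      (hS.compression hV hD hV₀ hSV fun t x hx => hbd t ▸ blockDiagonal_mapsTo_orthogonal K _ hx)
      rfl)

/-! ### Expansions and poles at β = ∞ -/

section Expansion

theorem AnalyticAt.exists_eq_add_smul {E : Type*} [NormedAddCommGroup E] [NormedSpace ℂ E]
    {f : ℂ → E} (hf : AnalyticAt ℂ f 0) :
    ∃ g : ℂ → E, AnalyticAt ℂ g 0 ∧ ∀ t, f t = f 0 + t • g t := by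
  obtain ⟨p, hp⟩ := hf
  refine ⟨dslope f 0, hp.has_fpower_series_dslope_fslope.analyticAt, fun t => ?_⟩
  have := sub_smul_dslope f 0 t
  rw [sub_zero] at this
  rw [this, add_sub_cancel]

theorem tendsto_I_mul_inv_atTop :
    Tendsto (fun β : ℝ => Complex.I * (β : ℂ)⁻¹) atTop (𝓝 0) := by
  have h : Tendsto (fun β : ℝ => ((β⁻¹ : ℝ) : ℂ)) atTop (𝓝 0) :=
    tendsto_ofReal_nhds_zero.comp tendsto_inv_atTop_zero
  simpa using h.const_mul Complex.I

theorem isBigO_pow_smul_inv {E : Type*} [NormedAddCommGroup E] [NormedSpace ℂ E] {g : ℂ → E}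
    (hg : AnalyticAt ℂ g 0) (n : ℕ) :
    (fun β : ℝ => (Complex.I * (β : ℂ)⁻¹) ^ n • g (Complex.I * (β : ℂ)⁻¹))
      =O[atTop] fun β : ℝ => (β⁻¹) ^ n := by
  have h₁ : (fun β : ℝ => (Complex.I * (β : ℂ)⁻¹) ^ n) =O[atTop] fun β : ℝ => (β⁻¹) ^ n :=
    IsBigO.of_bound 1 (Eventually.of_forall fun β => by simp)
  have h₂ : (fun β : ℝ => g (Complex.I * (β : ℂ)⁻¹)) =O[atTop] fun _ : ℝ => (1 : ℝ) :=
    (hg.continuousAt.tendsto.comp tendsto_I_mul_inv_atTop).isBigO_one ℝ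
  simpa using h₁.smul h₂

theorem AnalyticAt.isAnalyticAtInfinity {E : Type*} [NormedAddCommGroup E] [NormedSpace ℂ E]
    {g : ℂ → E} (hg : AnalyticAt ℂ g 0) :
    IsAnalyticAtInfinity fun β : ℝ => g (Complex.I * (β : ℂ)⁻¹) := by
  refine ⟨fun z => g (Complex.I * z), ?_, Eventually.of_forall fun β => rfl⟩
  refine AnalyticAt.comp (g := g) (f := fun z => Complex.I * z) ?_
    (analyticAt_const.mul analyticAt_id)
  simpa using hg

theorem hasPoleAtInfinity_of_analyticAt {h : ℂ → ℂ} (hh : AnalyticAt ℂ h 0) {c : ℂ} (hc : c ≠ 0) :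
    HasPoleAtInfinity fun β : ℝ => c * β + h (Complex.I * (β : ℂ)⁻¹) := by
  have hI : AnalyticAt ℂ (fun z => h (Complex.I * z)) 0 := by
    refine AnalyticAt.comp (g := h) (f := fun z => Complex.I * z) ?_
      (analyticAt_const.mul analyticAt_id)
    simpa using hh
  have hmer : MeromorphicAt (fun z => c * z⁻¹ + h (Complex.I * z)) 0 :=
    ((MeromorphicAt.const c 0).mul (MeromorphicAt.id 0).inv).add hI.meromorphicAt
  refine ⟨fun z => c * z⁻¹ + h (Complex.I * z), hmer, ?_, Eventually.of_forall fun β => by simp⟩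
  have hord : meromorphicOrderAt (fun z => c * z⁻¹ + h (Complex.I * z)) 0 =
      ((-1 : ℤ) : WithTop ℤ) := by
    rw [meromorphicOrderAt_eq_int_iff hmer]
    -- Multiplication by z leaves an analytic function with value c ≠ 0 at 0: the pole is simple.
    refine ⟨fun z => c + z * h (Complex.I * z), analyticAt_const.add (analyticAt_id.mul hI),
      by simpa using hc, ?_⟩
    filter_upwards [self_mem_nhdsWithin] with z hz
    have hz : z ≠ 0 := hz
    simp only [sub_zero, zpow_neg_one, smul_eq_mul]
    field_simp
  rw [hord]
  exact WithTop.coe_lt_coe.2 (by norm_num)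

end Expansion

/-! ### First and second order perturbation theory of the pencil -/

section Perturbation

variable {H : Type*} [NormedAddCommGroup H] [InnerProductSpace ℂ H]

theorem eventually_eq_of_smul_eq {f g : ℂ → H} (hf : ContinuousAt f 0) (hg : ContinuousAt g 0)
    (h : ∀ᶠ t in 𝓝 (0 : ℂ), t • f t = t • g t) : ∀ᶠ t in 𝓝 0, f t = g t := by
  refine ContinuousAt.eq_of_eventually_nhdsNE hf hg ?_
  filter_upwards [h.filter_mono nhdsWithin_le_nhds, self_mem_nhdsWithin] with t ht ht'
  exact smul_right_injective _ ht' ht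

/-- Rayleigh–Schrödinger perturbation theory of the pencil `B + t Ω`. -/
theorem exists_perturbation_expansion [FiniteDimensional ℂ H]
    {Ω B : Module.End ℂ H}
    (hΩ : LinearMap.IsSymmetric Ω) (hB : LinearMap.IsSymmetric B) {v : ℂ → H} {μ : ℂ → ℂ}
    (hv : AnalyticAt ℂ v 0) (hμ : AnalyticAt ℂ μ 0) (hnorm : ‖v 0‖ = 1)
    (h : ∀ᶠ t in 𝓝 0, B (v t) + t • Ω (v t) = μ t • v t) :
    ∃ (p q : ℂ → H) (g k : ℂ → ℂ), AnalyticAt ℂ p 0 ∧ AnalyticAt ℂ q 0 ∧ AnalyticAt ℂ g 0 ∧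
      AnalyticAt ℂ k 0 ∧ (∀ t, v t = v 0 + t • p t) ∧ (∀ t, p t = p 0 + t • q t) ∧
      (∀ t, μ t = μ 0 + t * g t) ∧ (∀ t, g t = g 0 + t * k t) ∧
      g 0 = inner ℂ (v 0) (Ω (v 0)) ∧ (μ 0 = 0 → k 0 = -inner ℂ (p 0) (B (p 0))) := by
  have hcB : Continuous B := B.continuous_of_finiteDimensional
  have hcΩ : Continuous Ω := Ω.continuous_of_finiteDimensional
  obtain ⟨p, hp, hvp⟩ := hv.exists_eq_add_smul
  obtain ⟨q, hq, hpq⟩ := hp.exists_eq_add_smul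
  obtain ⟨g, hg, hμg⟩ := hμ.exists_eq_add_smul
  obtain ⟨k, hk, hgk⟩ := hg.exists_eq_add_smul
  simp only [smul_eq_mul] at hμg hgk
  have h₀ : B (v 0) = μ 0 • v 0 := by simpa using h.self_of_nhds
  have hreal : (starRingEnd ℂ) (μ 0) = μ 0 := by
    have := hB (v 0) (v 0)
    rw [h₀, inner_smul_left, inner_smul_right, inner_self_eq_norm_sq_to_K, hnorm] at this
    simpa using this
  have hvv : inner ℂ (v 0) (v 0) = (1 : ℂ) := by
    rw [inner_self_eq_norm_sq_to_K, hnorm]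
    simp
  have h₁ : ∀ᶠ t in 𝓝 0, B (p t) + Ω (v t) = μ 0 • p t + g t • v t := by
    refine eventually_eq_of_smul_eq
      ((hcB.continuousAt.comp hp.continuousAt).add (hcΩ.continuousAt.comp hv.continuousAt))
      ((hp.continuousAt.const_smul _).add (hg.continuousAt.smul hv.continuousAt)) ?_
    filter_upwards [h] with t ht
    have e₁ : B (v t) = μ 0 • v 0 + t • B (p t) := by
      conv_lhs => rw [hvp t, map_add, map_smul, h₀]
    have e₂ : μ t • v t = μ 0 • v 0 + t • (μ 0 • p t + g t • v t) := by
      conv_lhs => rw [hμg t, add_smul]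
      conv_lhs => enter [1]; rw [hvp t]
      module
    rw [e₁, e₂, add_assoc, add_left_cancel_iff, ← smul_add] at ht
    exact ht
  have h₁' := h₁.self_of_nhds
  -- Pairing the first order equation with `v 0` cancels the `p 0` terms, because `B` is symmetric
  -- and `μ 0` is real.
  have hg0 : g 0 = inner ℂ (v 0) (Ω (v 0)) := by
    have := congrArg (inner ℂ (v 0)) h₁'
    rw [inner_add_right, inner_add_right, ← hB, h₀, inner_smul_left, hreal, inner_smul_right,
      inner_smul_right, hvv, mul_one, add_left_cancel_iff] at this
    exact this.symm
  refine ⟨p, q, g, k, hp, hq, hg, hk, hvp, hpq, hμg, hgk, hg0, fun hμ0 => ?_⟩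
  rw [hμ0, zero_smul] at h₀ h₁'
  have h₂ : ∀ᶠ t in 𝓝 0, B (q t) + Ω (p t) = k t • v t + g 0 • p t := by
    refine eventually_eq_of_smul_eq
      ((hcB.continuousAt.comp hq.continuousAt).add (hcΩ.continuousAt.comp hp.continuousAt))
      ((hk.continuousAt.smul hv.continuousAt).add (hp.continuousAt.const_smul _)) ?_
    filter_upwards [h₁] with t ht
    have e₁ : B (p t) = B (p 0) + t • B (q t) := by
      conv_lhs => rw [hpq t, map_add, map_smul]
    have e₂ : Ω (v t) = Ω (v 0) + t • Ω (p t) := by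
      conv_lhs => rw [hvp t, map_add, map_smul]
    have e₃ : g t • v t = g 0 • v 0 + t • (k t • v t + g 0 • p t) := by
      conv_lhs => rw [hgk t, add_smul]
      conv_lhs => enter [1]; rw [hvp t]
      module
    rw [e₁, e₂, e₃, hμ0, zero_smul, zero_add, add_add_add_comm, h₁', zero_add,
      add_left_cancel_iff, ← smul_add] at ht
    exact ht
  -- As `B (v 0) = 0`, pairing with `v 0` removes `q 0` and leaves k(0) = (Ωv(0) - g(0)v(0), p(0)).
  -- The first order equation, paired with `p 0`, turns this into -(p(0), Bp(0)); no normalization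
  -- of `v t` for t ≠ 0 is needed.
  have h₂' := congrArg (inner ℂ (v 0)) h₂.self_of_nhds
  have h₃ := congrArg (fun x => inner ℂ x (p 0)) h₁'
  simp only [zero_add, inner_add_left, inner_smul_left, hB (p 0)] at h₃
  have hgr : (starRingEnd ℂ) (g 0) = g 0 := by
    rw [hg0, inner_conj_symm, hΩ]
  rw [inner_add_right, ← hB, h₀, inner_zero_left, zero_add, inner_add_right, inner_smul_right,
    inner_smul_right, hvv, mul_one, ← hΩ] at h₂'
  rw [hgr, h₂'] at h₃
  linear_combination h₃

theorem systemOperator_apply_of_pencil {Ω B : Module.End ℂ H} {β : ℝ} (hβ : β ≠ 0) {w : H} {c : ℂ}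
    (h : B w + (Complex.I * (β : ℂ)⁻¹) • Ω w = c • w) :
    systemOperator Ω B β w = (-Complex.I * β * c) • w := by
  have hβ' : (β : ℂ) ≠ 0 := by exact_mod_cast hβ
  have h1 : (-Complex.I * β) * (Complex.I * (β : ℂ)⁻¹) = 1 := by
    field_simp
    simp
  rw [mul_smul, ← h, smul_add, smul_smul, h1]
  simp only [systemOperator, LinearMap.sub_apply, LinearMap.smul_apply]
  module

end Perturbation

/-! ### Eigenspaces and range of an operator with an orthonormal eigenbasis -/

section Diagonal

variable {H : Type*} [NormedAddCommGroup H] [InnerProductSpace ℂ H]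
  {ι : Type*} [Fintype ι]

theorem OrthonormalBasis.span_eq_eigenspace (b : OrthonormalBasis ι ℂ H) {B : Module.End ℂ H}
    {c : ι → ℂ} (h : ∀ j, B (b j) = c j • b j) (μ : ℂ) :
    Submodule.span ℂ (Set.range fun j : {j // c j = μ} => b j) = Module.End.eigenspace B μ := by
  refine le_antisymm ?_ fun x hx => ?_
  · rw [Submodule.span_le]
    rintro _ ⟨⟨j, rfl⟩, rfl⟩
    exact Module.End.mem_eigenspace_iff.2 (h j)
  · rw [Module.End.mem_eigenspace_iff] at hx
    have hrepr : ∀ j, c j * b.repr x j = μ * b.repr x j := by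
      have hBx : B x = ∑ j, (c j * b.repr x j) • b j := by
        conv_lhs => rw [← b.sum_repr x, map_sum]
        exact Finset.sum_congr rfl fun j _ => by rw [map_smul, h, smul_smul, mul_comm]
      have hμx : B x = ∑ j, (μ * b.repr x j) • b j := by
        rw [hx]
        conv_lhs => rw [← b.sum_repr x, Finset.smul_sum]
        exact Finset.sum_congr rfl fun j _ => by rw [smul_smul]
      have hli := Fintype.linearIndependent_iff.1 b.orthonormal.linearIndependent
        (fun j => c j * b.repr x j - μ * b.repr x j) (by
          simp only [sub_smul, Finset.sum_sub_distrib]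
          rw [← hBx, ← hμx, sub_self])
      exact fun j => sub_eq_zero.1 (hli j)
    rw [← b.sum_repr x]
    refine Submodule.sum_mem _ fun j _ => ?_
    by_cases hj : c j = μ
    · exact Submodule.smul_mem _ _ (Submodule.subset_span ⟨⟨j, hj⟩, rfl⟩)
    · have : b.repr x j = 0 := by
        by_contra h0
        exact hj (mul_right_cancel₀ h0 (hrepr j))
      rw [this, zero_smul]
      exact Submodule.zero_mem _

theorem OrthonormalBasis.card_eq_finrank_eigenspace (b : OrthonormalBasis ι ℂ H)
    {B : Module.End ℂ H} {c : ι → ℂ} (h : ∀ j, B (b j) = c j • b j) (μ : ℂ) :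
    Nat.card {j // c j = μ} = Module.finrank ℂ (Module.End.eigenspace B μ) := by
  classical
  rw [← b.span_eq_eigenspace h, Nat.card_eq_fintype_card]
  exact (finrank_span_eq_card
    (b.orthonormal.linearIndependent.comp _ Subtype.val_injective)).symm

theorem OrthonormalBasis.span_eq_range (b : OrthonormalBasis ι ℂ H) {B : Module.End ℂ H}
    {c : ι → ℂ} (h : ∀ j, B (b j) = c j • b j) :
    Submodule.span ℂ (Set.range fun j : {j // c j ≠ 0} => b j) = LinearMap.range B := by
  refine le_antisymm ?_ ?_
  · rw [Submodule.span_le]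
    rintro _ ⟨⟨j, hj⟩, rfl⟩
    exact ⟨(c j)⁻¹ • b j, by rw [map_smul, h, smul_smul, inv_mul_cancel₀ hj, one_smul]⟩
  · rintro _ ⟨x, rfl⟩
    rw [← b.sum_repr x, map_sum]
    refine Submodule.sum_mem _ fun j _ => ?_
    rw [map_smul, h]
    by_cases hj : c j = 0
    · simp [hj]
    · exact Submodule.smul_mem _ _ (Submodule.smul_mem _ _ (Submodule.subset_span ⟨⟨j, hj⟩, rfl⟩))

theorem isOrthonormalBasisOf_comp (b : OrthonormalBasis ι ℂ H) {p : ι → Prop} {κ : Type*}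
    (e : κ ≃ {j // p j}) {K : Submodule ℂ H}
    (h : Submodule.span ℂ (Set.range fun j : {j // p j} => b j) = K) :
    IsOrthonormalBasisOf (fun i => b (e i)) K := by
  refine ⟨b.orthonormal.comp _ (Subtype.val_injective.comp e.injective), ?_⟩
  rw [← h]
  congr 1
  exact e.surjective.range_comp fun j : {j // p j} => b j

end Diagonal

/-- Two families on finite types with fibres of equal cardinality differ by a reindexing. -/
theorem exists_equiv_of_card_fiber_eq {α β γ : Type*} [Finite α] [Finite β] (f : α → γ) (g : β → γ)
    (h : ∀ r, Nat.card {a // f a = r} = Nat.card {b // g b = r}) :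
    ∃ e : α ≃ β, ∀ a, g (e a) = f a := by
  have hE : ∀ r, Nonempty ({a // f a = r} ≃ {b // g b = r}) := fun r =>
    Finite.card_eq.1 (h r)
  refine ⟨((Equiv.sigmaFiberEquiv f).symm.trans (Equiv.sigmaCongrRight fun r => (hE r).some)).trans
    (Equiv.sigmaFiberEquiv g), fun a => ?_⟩
  exact ((hE (f a)).some ⟨a, rfl⟩).2

/-- The pencil is self-adjoint for real t, so the constant form 1 suffices. -/
theorem hasAnalyticEigenbasis_pencil {H : Type*} [NormedAddCommGroup H] [InnerProductSpace ℂ H]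
    [FiniteDimensional ℂ H] {Ω B : Module.End ℂ H} (hΩ : LinearMap.IsSymmetric Ω)
    (hB : LinearMap.IsSymmetric B) :
    HasAnalyticEigenbasis fun t : ℂ =>
      LinearMap.toContinuousLinearMap B + t • LinearMap.toContinuousLinearMap Ω := by
  have hB' : IsSelfAdjoint (LinearMap.toContinuousLinearMap B) :=
    ContinuousLinearMap.isSelfAdjoint_iff_isSymmetric.2 hB
  have hΩ' : IsSelfAdjoint (LinearMap.toContinuousLinearMap Ω) :=
    ContinuousLinearMap.isSelfAdjoint_iff_isSymmetric.2 hΩ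
  refine IsSymmetrizedBy.hasAnalyticEigenbasis (G := fun _ => 1)
    ⟨analyticAt_const.add (analyticAt_id.smul analyticAt_const), continuousAt_const, rfl,
      Eventually.of_forall fun _ => IsSelfAdjoint.one _, Eventually.of_forall fun t => ?_⟩
  rw [one_mul]
  exact hB'.add (IsSelfAdjoint.smul (by simp [isSelfAdjoint_iff]) hΩ')

/-- A family of vectors continuous at a point where it is a basis is a basis nearby. -/
theorem eventually_exists_basis {H : Type*} [NormedAddCommGroup H] [InnerProductSpace ℂ H]
    [FiniteDimensional ℂ H] {ι : Type*} [Fintype ι] (b : Module.Basis ι ℂ H) {v : ι → ℂ → H}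
    (hv : ∀ j, ContinuousAt (v j) 0) (hb : ∀ j, v j 0 = b j) :
    ∀ᶠ t in 𝓝 0, ∃ b' : Module.Basis ι ℂ H, ∀ j, b' j = v j t := by
  have hlim : Tendsto (fun t j => v j t) (𝓝 0) (𝓝 b) := by
    rw [tendsto_pi_nhds]
    intro j
    rw [← hb]
    exact hv j
  filter_upwards [hlim.eventually (LinearIndependent.eventually b.linearIndependent)] with t ht
  rcases isEmpty_or_nonempty ι with hι | hι
  · exact ⟨b, fun j => hι.elim j⟩
  · exact ⟨basisOfLinearIndependentOfCardEqFinrank ht (Module.finrank_eq_card_basis b).symm,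
      fun j => by simp⟩

theorem mainTheorem1
    {H : Type*} [NormedAddCommGroup H] [InnerProductSpace ℂ H] [FiniteDimensional ℂ H]
    (Ω B : Module.End ℂ H) (hΩ : LinearMap.IsSymmetric Ω) (hB : LinearMap.IsPositive B)
    (N N_B : ℕ) (hN : Module.finrank ℂ H = N)
    (hN_B : Module.finrank ℂ (lossSubspace B) = N_B)
    (h_pos : 0 < N_B) (h_lt : N_B < N)
    (ζ₀ : Fin N_B → ℝ) (hζ₀ : IsIndexingOfNonzeroEigenvalues B ζ₀) :
    (∀ᶠ β : ℝ in atTop, IsDiagonalizable (systemOperator Ω B β)) ∧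
    ∃ (ζ_high : Fin N_B → ℝ → ℂ) (w_high : Fin N_B → ℝ → H)
      (ζ_low : Fin (N - N_B) → ℝ → ℂ) (w_low : Fin (N - N_B) → ℝ → H),
      -- a complete set of eigenpairs
      (∀ᶠ β : ℝ in atTop,
        (∃ b : Module.Basis (Fin N_B ⊕ Fin (N - N_B)) ℂ H,
          (∀ j, b (Sum.inl j) = w_high j β) ∧ (∀ j, b (Sum.inr j) = w_low j β)) ∧
        (∀ j, systemOperator Ω B β (w_high j β) = ζ_high j β • w_high j β) ∧
        (∀ j, systemOperator Ω B β (w_low j β) = ζ_low j β • w_low j β)) ∧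
      -- the high-loss eigenpairs
      (∃ (ρ : Fin N_B → ℝ) (w₀ : Fin N_B → H),
        IsOrthonormalBasisOf w₀ (lossSubspace B) ∧
        ∀ j,
          HasPoleAtInfinity (ζ_high j) ∧
          IsAnalyticAtInfinity (w_high j) ∧
          0 < ζ₀ j ∧
          ((fun β : ℝ => ζ_high j β - (-Complex.I * (ζ₀ j : ℂ) * (β : ℂ) + (ρ j : ℂ)))
            =O[atTop] fun β : ℝ => β⁻¹) ∧
          ((fun β : ℝ => w_high j β - w₀ j) =O[atTop] fun β : ℝ => β⁻¹) ∧
          B (w₀ j) = (ζ₀ j : ℂ) • w₀ j ∧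
          (ρ j : ℂ) = inner ℂ (w₀ j) (Ω (w₀ j))) ∧
      -- the low-loss eigenpairs
      (∃ (ρ d : Fin (N - N_B) → ℝ) (w₀ w₁ : Fin (N - N_B) → H),
        IsOrthonormalBasisOf w₀ (noLossSubspace B) ∧
        ∀ j,
          IsAnalyticAtInfinity (ζ_low j) ∧
          IsAnalyticAtInfinity (w_low j) ∧
          0 ≤ d j ∧
          ((fun β : ℝ => ζ_low j β - ((ρ j : ℂ) - Complex.I * (d j : ℂ) * (β : ℂ)⁻¹))
            =O[atTop] fun β : ℝ => (β⁻¹) ^ 2) ∧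
          ((fun β : ℝ => w_low j β - (w₀ j + (β : ℂ)⁻¹ • w₁ j))
            =O[atTop] fun β : ℝ => (β⁻¹) ^ 2) ∧
          B (w₀ j) = 0 ∧
          (ρ j : ℂ) = inner ℂ (w₀ j) (Ω (w₀ j)) ∧
          (d j : ℂ) = inner ℂ (w₁ j) (B (w₁ j))) := by
  obtain ⟨ι, _, b, v, μ, hvμ⟩ := hasAnalyticEigenbasis_pencil hΩ hB.isSymmetric
  choose hv hμ hvb hev using hvμ
  have hev' : ∀ j, ∀ᶠ t in 𝓝 (0 : ℂ), B (v j t) + t • Ω (v j t) = μ j t • v j t := fun j =>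
    (hev j).mono fun t ht => by simpa using ht
  have hnorm : ∀ j, ‖v j 0‖ = 1 := fun j => by rw [hvb]; exact b.orthonormal.1 j
  choose p q g k hp hq hg hk hvp hpq hμg hgk hg₀ hk₀ using fun j =>
    exists_perturbation_expansion hΩ hB.isSymmetric (hv j) (hμ j) (hnorm j) (hev' j)
  have hBb : ∀ j, B (b j) = μ j 0 • b j := fun j => by
    simpa [hvb] using (hev' j).self_of_nhds
  -- The prescribed indexing and the nonzero μ_j(0) both count dimensions of eigenspaces of `B`, so
  -- a bijection `e` matches them value by value.
  have hindex : ∀ r : ℂ, Nat.card {i : Fin N_B // (ζ₀ i : ℂ) = r} =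
      Nat.card {j : {j : ι // μ j 0 ≠ 0} // μ j 0 = r} := by
    intro r
    rcases eq_or_ne r 0 with rfl | hr
    · have h₁ : IsEmpty {i : Fin N_B // (ζ₀ i : ℂ) = 0} :=
        ⟨fun i => hζ₀.1 i.1 (by exact_mod_cast i.2)⟩
      have h₂ : IsEmpty {j : {j : ι // μ j 0 ≠ 0} // μ j 0 = 0} := ⟨fun j => j.1.2 j.2⟩
      rw [Nat.card_of_isEmpty, Nat.card_of_isEmpty]
    · rw [hζ₀.2 r hr, ← b.card_eq_finrank_eigenspace hBb]
      exact (Nat.card_congr (Equiv.subtypeSubtypeEquivSubtype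
        (p := fun j => μ j 0 ≠ 0) (q := fun j => μ j 0 = r) fun h => h ▸ hr)).symm
  obtain ⟨e, he⟩ := exists_equiv_of_card_fiber_eq _ _ hindex
  classical
  have hcard : Fintype.card {j : ι // ¬ μ j 0 ≠ 0} = N - N_B := by
    rw [Fintype.card_subtype_compl, ← hN, Module.finrank_eq_card_basis b.toBasis,
      ← Fintype.card_congr e, Fintype.card_fin]
  have e' : Fin (N - N_B) ≃ {j : ι // ¬ μ j 0 ≠ 0} := (Fintype.equivFinOfCardEq hcard).symm
  have he' : ∀ i, μ (e' i) 0 = 0 := fun i => not_not.1 (e' i).2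
  have hbasis := tendsto_I_mul_inv_atTop.eventually
    (eventually_exists_basis b.toBasis (fun j => (hv j).continuousAt) (by simpa using hvb))
  let w : ι → ℝ → H := fun j β => v j (Complex.I * (β : ℂ)⁻¹)
  -- This is -iβ μ_j(t) with μ_j(t) = μ_j(0) + t g_j(t) and t = i/β, since -iβt = 1.
  let ζ : ι → ℝ → ℂ := fun j β => -Complex.I * μ j 0 * β + g j (Complex.I * (β : ℂ)⁻¹)
  have heig : ∀ᶠ β : ℝ in atTop, ∀ j, systemOperator Ω B β (w j β) = ζ j β • w j β := by
    filter_upwards [tendsto_I_mul_inv_atTop.eventually (eventually_all.2 hev'),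
      eventually_ne_atTop 0] with β h hβ j
    have hβ' : (β : ℂ) ≠ 0 := by exact_mod_cast hβ
    rw [systemOperator_apply_of_pencil hβ (h j), hμg j]
    congr 1
    simp only [ζ]
    field_simp
    linear_combination (-g j (Complex.I / β)) * Complex.I_sq
  have hpos : ∀ x, 0 ≤ (inner ℂ x (B x)).re := fun x => hB.re_inner_nonneg_right x
  have hζpos : ∀ i, 0 < ζ₀ i := by
    intro i
    refine lt_of_le_of_ne ?_ (hζ₀.1 i).symm
    have := hpos (b (e i))
    rw [hBb, he, inner_smul_right, inner_self_eq_norm_sq_to_K, b.orthonormal.1] at this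
    simpa using this
  have hreal : ∀ {T : Module.End ℂ H}, LinearMap.IsSymmetric T → ∀ x : H,
      (((inner ℂ x (T x)).re : ℝ) : ℂ) = inner ℂ x (T x) := fun hT x =>
    Complex.conj_eq_iff_re.1 (by rw [inner_conj_symm, hT])
  have hwO : ∀ j, (fun β : ℝ => w j β - b j) =O[atTop] fun β : ℝ => β⁻¹ := fun j => by
    refine ((isBigO_pow_smul_inv (hp j) 1).congr (fun β => ?_) fun β => pow_one _)
    simp only [w, hvp j (Complex.I * (β : ℂ)⁻¹), hvb, pow_one, add_sub_cancel_left]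
  refine ⟨?_, fun i => ζ (e i), fun i => w (e i), fun i => ζ (e' i), fun i => w (e' i), ?_, ?_, ?_⟩
  · filter_upwards [hbasis, heig] with β ⟨b', hb'⟩ h
    let f : ι ≃ Fin (Module.finrank ℂ H) :=
      Fintype.equivFinOfCardEq (Module.finrank_eq_card_basis b.toBasis).symm
    refine ⟨b'.reindex f, fun i => ζ (f.symm i) β, fun i => ?_⟩
    rw [Module.Basis.reindex_apply, hb']
    exact h _
  · filter_upwards [hbasis, heig] with β ⟨b', hb'⟩ h
    refine ⟨⟨b'.reindex ((e.sumCongr e').trans (Equiv.sumCompl fun j => μ j 0 ≠ 0)).symm,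
      fun i => ?_, fun i => ?_⟩, fun i => h _, fun i => h _⟩
    · simp [hb', w]
    · simp [hb', w]
  · refine ⟨fun i => (inner ℂ (b (e i)) (Ω (b (e i)))).re, fun i => b (e i),
      isOrthonormalBasisOf_comp b e (b.span_eq_range hBb), fun i => ⟨?_, ?_, hζpos i, ?_, hwO _,
        ?_, hreal hΩ _⟩⟩
    · exact hasPoleAtInfinity_of_analyticAt (hg (e i))
        (mul_ne_zero (neg_ne_zero.2 Complex.I_ne_zero) (e i).2)
    · exact (hv (e i)).isAnalyticAtInfinity
    · refine ((isBigO_pow_smul_inv (hk (e i)) 1).congr (fun β => ?_) fun β => pow_one _)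
      simp only [ζ, he, hgk (e i) (Complex.I * (β : ℂ)⁻¹), hg₀, hvb, hreal hΩ, pow_one,
        smul_eq_mul]
      ring
    · rw [hBb, he]
  -- The first order term t p(0) equals β⁻¹ · i p(0), hence the vector `Complex.I • p (e' i) 0`. The
  -- factor i drops out of the quadratic form of `B`, and t k(0) = -(i/β)(p(0), Bp(0)) gives the
  -- sign of the damping term.
  · refine ⟨fun i => (inner ℂ (b (e' i)) (Ω (b (e' i)))).re,
      fun i => (inner ℂ (p (e' i) 0) (B (p (e' i) 0))).re, fun i => b (e' i),
      fun i => Complex.I • p (e' i) 0, ?_, fun i => ⟨?_, (hv (e' i)).isAnalyticAtInfinity, hpos _,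
        ?_, ?_, ?_, hreal hΩ _, ?_⟩⟩
    · refine isOrthonormalBasisOf_comp b
        (e'.trans (Equiv.subtypeEquivRight fun j => not_not (a := μ j 0 = 0))) ?_
      rw [noLossSubspace, lossSubspace, hB.isSymmetric.orthogonal_range,
        ← Module.End.eigenspace_zero, ← b.span_eq_eigenspace hBb]
    · have : ζ (e' i) = fun β : ℝ => g (e' i) (Complex.I * (β : ℂ)⁻¹) := by
        funext β
        simp [ζ, he']
      change IsAnalyticAtInfinity (ζ (e' i))
      rw [this]
      exact (hg (e' i)).isAnalyticAtInfinity
    · obtain ⟨l, hl, hkl⟩ := (hk (e' i)).exists_eq_add_smul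
      refine (isBigO_pow_smul_inv hl 2).congr (fun β => ?_) fun β => rfl
      simp only [ζ, he', hgk (e' i) (Complex.I * (β : ℂ)⁻¹), hkl (Complex.I * (β : ℂ)⁻¹),
        hk₀ _ (he' i), hg₀, hvb, hreal hΩ, hreal hB.isSymmetric, smul_eq_mul]
      ring
    · refine (isBigO_pow_smul_inv (hq (e' i)) 2).congr (fun β => ?_) fun β => rfl
      simp only [w, hvp (e' i) (Complex.I * (β : ℂ)⁻¹), hpq (e' i) (Complex.I * (β : ℂ)⁻¹), hvb]
      module
    · rw [hBb, he', zero_smul]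
    · rw [hreal hB.isSymmetric, map_smul, inner_smul_left, inner_smul_right, ← mul_assoc]
      simp
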